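/- For an open set $\Omega\subseteq\mathbb R^d$ let $\mathcal F(\Omega)$ be the set of functions $f:\mathbb R^d\to\mathbb R$ with closed support contained in $\Omega$, $f(0)=1$, and $f$ positive definite, i.e. $\hat f(\xi)=\int_{\mathbb R^d} f(x)e^{-2\pi i\langle x,\xi\rangle}\,dx$ is real and $\hat f(\xi)\ge 0$ for all $\xi\in\mathbb R^d$. For $z\in\mathbb R^d$ put $$\mathcal M(\Omega,z)=\sup_{f\in\mathcal F(\Omega)} f(z),\qquad \mathbb N_2=\{2,3,4,\dots\},\qquad H(\Omega,z)=\{k\in\mathbb N_2 : kz\in\Omega,\ -kz\in\Omega\}.$$ Here the functions $f$ are taken from a fixed regularity class $\mathcal C$, which may be any set of functions that contains all compactly supported $C^\infty$ functions $\mathbb R^d\to\mathbb R$ and consists of integrable functions continuous at $0$ and at $z$ (for instance $C_c^\infty$, or all continuous integrable functions). Let $\Omega\subseteq\mathbb R^d$ be open with $0\in\Omega$ and $z\in\Omega\cap(-\Omega)$. Let $\Omega^*\subseteq\mathbb R^d$ be any open set, symmetric about $0$, that contains $0$, $z$ and all points of $(\mathbb N_2\setminus H(\Omega,z))z=\{kz: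 k\in\mathbb N_2\setminus H(\Omega,z)\}$, and that is disjoint from $H(\Omega,z)z=\{kz:k\in H(\Omega,z)\}$. Then $$\mathcal M(\Omega,z)\,\mathcal M(\Omega^*,z)=\tfrac12 .$$ -/

import Mathlib

noncomputable section

namespace BoasKac

/-- A real function on `ℝᵈ` is positive definite if its Fourier transform
`ξ ↦ ∫ exp (-2πi⟨x, ξ⟩) f x dx` is real and nonnegative at every point.
It is applied to integrable functions only. -/
def PosDef {d : ℕ} (f : EuclideanSpace ℝ (Fin d) → ℝ) : Prop :=
  ∀ ξ : EuclideanSpace ℝ (Fin d),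
    (FourierTransform.fourier (fun x => (f x : ℂ)) ξ).im = 0 ∧
      0 ≤ (FourierTransform.fourier (fun x => (f x : ℂ)) ξ).re

/-- The smooth compactly supported real functions on `ℝᵈ`: the smallest regularity class. -/
def smoothFunctions (d : ℕ) : Set (EuclideanSpace ℝ (Fin d) → ℝ) :=
  {f | ContDiff ℝ (⊤ : ℕ∞) f ∧ HasCompactSupport f}

/-- The integrable real functions on `ℝᵈ` that are continuous at the two points `0` and `z` at
which values are taken: the largest regularity class. -/
def integrableFunctions {d : ℕ} (z : EuclideanSpace ℝ (Fin d)) :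
    Set (EuclideanSpace ℝ (Fin d) → ℝ) :=
  {f | MeasureTheory.Integrable f ∧ ContinuousAt f 0 ∧ ContinuousAt f z}

/-- `𝓕(Ω)`, within the regularity class `C`: positive definite `f` with `supp f ⊆ Ω` (`supp`
being the closed support) and `f 0 = 1`. -/
def admissible {d : ℕ} (C : Set (EuclideanSpace ℝ (Fin d) → ℝ))
    (Ω : Set (EuclideanSpace ℝ (Fin d))) : Set (EuclideanSpace ℝ (Fin d) → ℝ) :=
  {f | f ∈ C ∧ tsupport f ⊆ Ω ∧ f 0 = 1 ∧ PosDef f}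

/-- The pointwise extremal quantity `𝓜(Ω, z) = sup {f z | f ∈ 𝓕(Ω)}`. -/
def extremal {d : ℕ} (C : Set (EuclideanSpace ℝ (Fin d) → ℝ))
    (Ω : Set (EuclideanSpace ℝ (Fin d))) (z : EuclideanSpace ℝ (Fin d)) : ℝ :=
  sSup ((fun f => f z) '' admissible C Ω)

/-- `H(Ω, z) = {k ∈ ℕ₂ | kz ∈ Ω, -kz ∈ Ω}`, where `ℕ₂ = {2, 3, 4, …}`. -/
def indexSet {d : ℕ} (Ω : Set (EuclideanSpace ℝ (Fin d)))
    (z : EuclideanSpace ℝ (Fin d)) : Set ℕ :=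
  {k | 2 ≤ k ∧ k • z ∈ Ω ∧ -(k • z) ∈ Ω}

end BoasKac

end

open MeasureTheory Filter Topology Real FourierTransform Complex Finset
open scoped RealInnerProductSpace InnerProductSpace

namespace BoasKac

/-! Everything reduces to sequences on the multiples of `z`.

Upper bound (`mul_apply_le_half`): for admissible `f` and `g`, the sequence `n ↦ f (n • z) * g (n •
z)`, read through Fourier inversion, is positive definite as a product of two such sequences. It
vanishes for `|n| ≥ 2`, because `Ω` and `Ωs` share no relevant multiple of `z`. Testing it on the
alternating vector `(-1)^j` of length `N + 1` gives `2 N f(z) g(z) ≤ N + 1`, hence `f(z) g(z) ≤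
1/2`.

Lower bound: a nonnegative cosine polynomial with `c 0 = 1` and frequencies allowed by the set
becomes an admissible function with value `c 1 / 2` at `z`, by placing small positive definite bumps
at the multiples of `z` (`exists_admissible_of_cosine`). So `c 1 ≤ 2 𝓜(Ω, z)` for frequencies in
`{0, 1} ∪ H`. Convex duality (`exists_dual_functional`, by Riesz extension) yields a functional that
is nonnegative on all nonnegative cosine polynomials and kills the frequencies in `H`. Its
alternating Fejér sums (`exists_cosCone_of_functional`) are cosine polynomials admissible for `Ωs`,
with `c 1 / c 0 = 2N / ((N + 1) · 2 𝓜(Ω, z))`; let `N → ∞`. -/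

/-! ### Fourier inversion for positive definite functions. -/

/-- An integrable function with nonnegative Fourier transform which is continuous at the origin
has an integrable Fourier transform. -/
theorem integrable_fourier_of_nonneg {V : Type*} [NormedAddCommGroup V] [InnerProductSpace ℝ V]
    [MeasurableSpace V] [BorelSpace V] [FiniteDimensional ℝ V] {F : V → ℂ}
    (hF : Integrable F) (h0 : ContinuousAt F 0)
    (hpos : ∀ ξ, (𝓕 F ξ).im = 0 ∧ 0 ≤ (𝓕 F ξ).re) : Integrable (𝓕 F) := by
  have hcont : Continuous (𝓕 F) :=
    VectorFourier.fourierIntegral_continuous Real.continuous_fourierChar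
      (by exact continuous_inner) hF
  -- The multiplication formula moves the transform onto the Gaussian, which becomes an approximate
  -- identity at the origin.
  have hB : Tendsto (fun c : ℝ => ∫ w : V, cexp (-((c⁻¹ : ℝ) : ℂ) * ‖w‖ ^ 2) • 𝓕 F w) atTop (𝓝 (F 0)) := by
    refine (Real.tendsto_integral_gaussian_smul' hF h0).congr' ?_
    filter_upwards [Ioi_mem_atTop 0] with c (hc : 0 < c)
    have J : Integrable (fun w : V => cexp (-((c⁻¹ : ℝ) : ℂ) * ‖w‖ ^ 2)) := by
      simpa using GaussianFourier.integrable_cexp_neg_mul_sq_norm_add (V := V) (b := ((c⁻¹ : ℝ) : ℂ))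
        (by simpa using hc) 0 0
    have key := VectorFourier.integral_fourierIntegral_smul_eq_flip (L := innerₗ V)
      (μ := volume) (ν := volume) Real.continuous_fourierChar continuous_inner J hF
    have key' : ∫ w : V, 𝓕 (fun w : V => cexp (-((c⁻¹ : ℝ) : ℂ) * ‖w‖ ^ 2)) w • F w =
        ∫ w : V, cexp (-((c⁻¹ : ℝ) : ℂ) * ‖w‖ ^ 2) • 𝓕 F w := by
      simpa using! key
    rw [← key']
    congr with w
    rw [fourier_gaussian_innerProductSpace (by simpa using hc)]
    congr 1
    congr 1
    · simp
    · simp; ring_nf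
  -- Nonnegativity enters here: the integrals in `hB` are `L¹` norms, hence bounded along the
  -- sequence, and Fatou's lemma passes the bound to `𝓕 F`.
  have hnorm : ∀ n : ℕ, ∀ w : V, ‖cexp (-(((n : ℝ)⁻¹ : ℝ) : ℂ) * ‖w‖ ^ 2) • 𝓕 F w‖ =
      (cexp (-(((n : ℝ)⁻¹ : ℝ) : ℂ) * ‖w‖ ^ 2) • 𝓕 F w).re := by
    intro n w
    have he : cexp (-(((n : ℝ)⁻¹ : ℝ) : ℂ) * ‖w‖ ^ 2) = ((Real.exp (-(n : ℝ)⁻¹ * ‖w‖ ^ 2) : ℝ) : ℂ) := by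
      push_cast; rfl
    have hre : 𝓕 F w = (((𝓕 F w).re : ℝ) : ℂ) := Complex.ext rfl (by simpa using (hpos w).1)
    rw [he, hre, smul_eq_mul, ← Complex.ofReal_mul, Complex.norm_real, Complex.ofReal_re,
      Real.norm_of_nonneg (mul_nonneg (Real.exp_nonneg _) (hpos w).2)]
  have hint : ∀ n : ℕ, 0 < n → Integrable (fun w : V =>
      cexp (-(((n : ℝ)⁻¹ : ℝ) : ℂ) * ‖w‖ ^ 2) • 𝓕 F w) := by
    intro n hn
    have J : Integrable (fun w : V => cexp (-(((n : ℝ)⁻¹ : ℝ) : ℂ) * ‖w‖ ^ 2)) := by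
      simpa using GaussianFourier.integrable_cexp_neg_mul_sq_norm_add (V := V)
        (b := (((n : ℝ)⁻¹ : ℝ) : ℂ)) (by simpa using hn) 0 0
    refine J.smul_bdd (∫ v, ‖F v‖) hcont.aestronglyMeasurable (Eventually.of_forall fun w => ?_)
    exact VectorFourier.norm_fourierIntegral_le_integral_norm _ _ _ _ _
  have hlim : Tendsto (fun n : ℕ => ∫ w : V, ‖cexp (-((((n + 1 : ℕ) : ℝ)⁻¹ : ℝ) : ℂ) * ‖w‖ ^ 2) • 𝓕 F w‖)
      atTop (𝓝 (F 0).re) := by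
    have h1 := (Complex.continuous_re.tendsto _).comp
      (hB.comp (tendsto_natCast_atTop_atTop.comp (tendsto_add_atTop_nat 1)))
    refine h1.congr fun n => ?_
    simp only [Function.comp_apply, hnorm]
    exact (integral_re (hint (n + 1) n.succ_pos)).symm
  obtain ⟨M, hM⟩ := hlim.bddAbove_range
  refine ⟨hcont.aestronglyMeasurable, ?_⟩
  have hfat : ∫⁻ w, ‖𝓕 F w‖ₑ ≤ liminf (fun n : ℕ =>
      ∫⁻ w : V, ‖cexp (-((((n + 1 : ℕ) : ℝ)⁻¹ : ℝ) : ℂ) * ‖w‖ ^ 2) • 𝓕 F w‖ₑ) atTop := by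
    refine (lintegral_congr fun w => ?_).trans_le
      (lintegral_liminf_le' fun n => (hint (n + 1) n.succ_pos).1.enorm)
    have : Tendsto (fun c : ℝ => cexp (-((c⁻¹ : ℝ) : ℂ) * ‖w‖ ^ 2) • 𝓕 F w) atTop (𝓝 (𝓕 F w)) := by
      nth_rewrite 2 [show 𝓕 F w = cexp (-((0 : ℝ) : ℂ) * ‖w‖ ^ 2) • 𝓕 F w by simp]
      apply (Tendsto.cexp _).smul_const
      have := (tendsto_inv_atTop_zero (𝕜 := ℝ)).ofReal.neg.mul_const ((‖w‖ : ℂ) ^ 2)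
      simpa using this
    exact (this.comp (tendsto_natCast_atTop_atTop.comp (tendsto_add_atTop_nat 1))).enorm.liminf_eq.symm
  refine (hfat.trans (liminf_le_of_frequently_le' (x := ENNReal.ofReal M)
    (Frequently.of_forall fun n => ?_))).trans_lt ENNReal.ofReal_lt_top
  rw [← ofReal_integral_norm_eq_lintegral_enorm (hint (n + 1) n.succ_pos)]
  exact ENNReal.ofReal_le_ofReal (hM ⟨n, rfl⟩)

variable {d : ℕ}

/-- The data extracted from an admissible function: at `0`, at `z` and off the closed support, it is
given by an absolutely convergent inverse Fourier integral of a nonnegative function. -/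
theorem exists_spectral_density {z : EuclideanSpace ℝ (Fin d)} {f : EuclideanSpace ℝ (Fin d) → ℝ}
    (hf : f ∈ integrableFunctions z) (hpos : PosDef f) :
    ∃ p : EuclideanSpace ℝ (Fin d) → ℝ, Integrable p ∧ (∀ ξ, 0 ≤ p ξ) ∧
      ∀ x, x = 0 ∨ x = z ∨ x ∉ tsupport f →
        ∫ ξ, 𝐞 ⟪ξ, x⟫_ℝ • (p ξ : ℂ) = f x := by
  obtain ⟨hint, hc0, hcz⟩ := hf
  have hF : Integrable (fun x => (f x : ℂ)) := hint.ofReal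
  have hC : ∀ x, ContinuousAt f x → ContinuousAt (fun x => (f x : ℂ)) x := fun x h =>
    Complex.continuous_ofReal.continuousAt.comp h
  have hFF := integrable_fourier_of_nonneg hF (hC 0 hc0) hpos
  have hre : ∀ ξ, (((𝓕 (fun x => (f x : ℂ)) ξ).re : ℝ) : ℂ) = 𝓕 (fun x => (f x : ℂ)) ξ :=
    fun ξ => Complex.ext rfl (by simpa using (hpos ξ).1.symm)
  refine ⟨fun ξ => (𝓕 (fun x => (f x : ℂ)) ξ).re, hFF.re, fun ξ => (hpos ξ).2, fun x hx => ?_⟩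
  have hcx : ContinuousAt f x := by
    rcases hx with rfl | rfl | hx
    · exact hc0
    · exact hcz
    -- Off the closed support `f` vanishes near `x`, so inversion holds there although `f` need not
    -- be continuous elsewhere.
    · exact (continuousAt_const (y := (0 : ℝ))).congr
        ((notMem_tsupport_iff_eventuallyEq.mp hx).symm)
  simp_rw [hre]
  rw [← Real.fourierInv_eq]
  exact hF.fourierInv_fourier_eq hFF (hC x hcx)

/-! ### The upper bound through Toeplitz forms. -/

/-- A Toeplitz sum over a tridiagonal symbol. -/
theorem sum_sum_tridiagonal {R : Type*} [CommRing R] (h : ℤ → R)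
    (hh : ∀ n : ℤ, 2 ≤ |n| → h n = 0) (N : ℕ) :
    ∑ j ∈ range (N + 1), ∑ l ∈ range (N + 1), h ((j : ℤ) - l) =
      (N + 1) * h 0 + N * (h 1 + h (-1)) := by
  induction N with
  | zero => simp
  | succ N ih =>
    rw [sum_range_succ]
    simp_rw [fun j : ℕ => sum_range_succ (fun l : ℕ => h ((j : ℤ) - l)) (N + 1)]
    rw [sum_add_distrib, ih, sum_range_succ (fun j : ℕ => h ((j : ℤ) - ((N + 1 : ℕ) : ℤ))),
      sum_range_succ (fun l : ℕ => h (((N + 1 : ℕ) : ℤ) - l)),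
      sum_eq_zero (fun j hj => hh _ ?_), sum_eq_zero (fun j hj => hh _ ?_)]
    · have e1 : (N : ℤ) - ((N + 1 : ℕ) : ℤ) = -1 := by push_cast; ring
      have e2 : ((N + 1 : ℕ) : ℤ) - N = 1 := by push_cast; ring
      rw [e1, e2, sub_self]
      push_cast
      ring
    · have := mem_range.mp hj
      rw [abs_of_nonneg] <;> push_cast <;> omega
    · have := mem_range.mp hj
      rw [abs_of_nonpos] <;> push_cast <;> omega

section Toeplitz

variable {V : Type*} [NormedAddCommGroup V] [InnerProductSpace ℝ V] [MeasurableSpace V]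
  [BorelSpace V] [FiniteDimensional ℝ V]

theorem integrable_fourierChar_smul {p : V → ℝ} (hp : Integrable p) (x : V) :
    Integrable (fun ξ => 𝐞 ⟪ξ, x⟫_ℝ • (p ξ : ℂ)) := by
  have := (Real.fourierIntegral_convergent_iff (-x)).2 (hp.ofReal (𝕜 := ℂ))
  simpa using this

theorem re_sum_integral_fourierChar_nonneg {ι : Type*} (s : Finset ι) (a : ι → ℂ) (x : ι → V)
    {p : V → ℝ} (hp : Integrable p) (hp0 : ∀ ξ, 0 ≤ p ξ)
    (h : ∀ ξ, 0 ≤ (∑ i ∈ s, a i * 𝐞 ⟪ξ, x i⟫_ℝ).re) :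
    0 ≤ (∑ i ∈ s, a i * ∫ ξ, 𝐞 ⟪ξ, x i⟫_ℝ • (p ξ : ℂ)).re := by
  have hint : ∀ i ∈ s, Integrable (fun ξ => a i * 𝐞 ⟪ξ, x i⟫_ℝ • (p ξ : ℂ)) :=
    fun i _ => (integrable_fourierChar_smul hp (x i)).const_mul (a i)
  simp_rw [← integral_const_mul]
  rw [← integral_finsetSum s hint]
  refine le_of_le_of_eq ?_ (integral_re (𝕜 := ℂ) (integrable_finsetSum s hint))
  refine integral_nonneg fun ξ => ?_
  have e : ∑ i ∈ s, a i * 𝐞 ⟪ξ, x i⟫_ℝ • (p ξ : ℂ) = (p ξ : ℂ) * ∑ i ∈ s, a i * 𝐞 ⟪ξ, x i⟫_ℝ := by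
    rw [mul_sum]
    refine sum_congr rfl fun i _ => ?_
    rw [Circle.smul_def, smul_eq_mul]
    ring
  change 0 ≤ (∑ i ∈ s, a i * 𝐞 ⟪ξ, x i⟫_ℝ • (p ξ : ℂ)).re
  rw [e, Complex.re_ofReal_mul]
  exact mul_nonneg (hp0 ξ) (h ξ)

theorem integral_fourierChar_neg (p : V → ℝ) (x : V) :
    ∫ ξ, 𝐞 ⟪ξ, -x⟫_ℝ • (p ξ : ℂ) = (starRingEnd ℂ) (∫ ξ, 𝐞 ⟪ξ, x⟫_ℝ • (p ξ : ℂ)) := by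
  rw [← integral_conj]
  congr with ξ
  simp [Circle.smul_def, AddChar.map_neg_eq_inv, ← Circle.coe_inv_eq_conj]

/-- The double sum is `|∑ (-1)^j e^{ijθ}|²`. The alternating signs make the first off-diagonals
enter negatively, which is what bounds `f z * g z` from above. -/
theorem re_sum_sum_exp_nonneg (N : ℕ) (θ : ℝ) :
    0 ≤ (∑ q ∈ range N ×ˢ range N,
      ((-1 : ℂ) ^ (q.1 + q.2)) * cexp (((q.1 : ℤ) - (q.2 : ℤ) : ℤ) * (θ * I))).re := by
  have : ∑ q ∈ range N ×ˢ range N,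
      ((-1 : ℂ) ^ (q.1 + q.2)) * cexp (((q.1 : ℤ) - (q.2 : ℤ) : ℤ) * (θ * I)) =
      (∑ j ∈ range N, (-1 : ℂ) ^ j * cexp (j * (θ * I))) *
        (starRingEnd ℂ) (∑ j ∈ range N, (-1 : ℂ) ^ j * cexp (j * (θ * I))) := by
    rw [map_sum, sum_mul_sum, sum_product]
    refine sum_congr rfl fun j _ => sum_congr rfl fun l _ => ?_
    rw [map_mul, ← Complex.exp_conj]
    simp only [map_mul, map_pow, map_neg, map_one, Complex.conj_I, Complex.conj_ofReal,
      map_natCast]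
    rw [mul_mul_mul_comm, ← Complex.exp_add, ← pow_add]
    congr 2
    push_cast
    ring
  rw [this, Complex.mul_conj, Complex.ofReal_re]
  exact Complex.normSq_nonneg _

end Toeplitz

/-- Two functions which are positive definite and have no common multiple `kz`, `2 ≤ k`, in their
supports satisfy `f z * g z ≤ 1 / 2`. -/
theorem mul_apply_le_half {z : EuclideanSpace ℝ (Fin d)}
    {C : Set (EuclideanSpace ℝ (Fin d) → ℝ)} (hC : C ⊆ integrableFunctions z)
    {Ω Ωs : Set (EuclideanSpace ℝ (Fin d))}
    (hdisj : Disjoint Ωs ((fun k : ℕ => k • z) '' indexSet Ω z))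
    {f g : EuclideanSpace ℝ (Fin d) → ℝ} (hf : f ∈ admissible C Ω) (hg : g ∈ admissible C Ωs) :
    f z * g z ≤ 1 / 2 := by
  obtain ⟨hfC, hfs, hf0, hfp⟩ := hf
  obtain ⟨hgC, hgs, hg0, hgp⟩ := hg
  obtain ⟨p, hp, hp0, hpf⟩ := exists_spectral_density (hC hfC) hfp
  obtain ⟨q, hq, hq0, hqg⟩ := exists_spectral_density (hC hgC) hgp
  -- `F` may differ from `f` at points of the support where `f` is discontinuous. Only its values at
  -- `0`, at `z` and outside `Ω` are ever compared with `f`.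
  set F : EuclideanSpace ℝ (Fin d) → ℂ := fun x => ∫ ξ, 𝐞 ⟪ξ, x⟫_ℝ • (p ξ : ℂ) with hF
  set G : EuclideanSpace ℝ (Fin d) → ℂ := fun x => ∫ ξ, 𝐞 ⟪ξ, x⟫_ℝ • (q ξ : ℂ) with hG
  have hFneg : ∀ x, F (-x) = (starRingEnd ℂ) (F x) := integral_fourierChar_neg p
  have hGneg : ∀ x, G (-x) = (starRingEnd ℂ) (G x) := integral_fourierChar_neg q
  have hF0 : ∀ x, x ∉ Ω → F x = 0 := fun x hx => by
    have := fun h => hx (hfs h)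
    rw [hF]; simp only
    rw [hpf x (Or.inr (Or.inr this)), image_eq_zero_of_notMem_tsupport this, Complex.ofReal_zero]
  have hG0 : ∀ x, x ∉ Ωs → G x = 0 := fun x hx => by
    have := fun h => hx (hgs h)
    rw [hG]; simp only
    rw [hqg x (Or.inr (Or.inr this)), image_eq_zero_of_notMem_tsupport this, Complex.ofReal_zero]
  have hnat : ∀ k : ℕ, 2 ≤ k → F (k • z) * G (k • z) = 0 := by
    intro k hk
    by_cases hkH : k ∈ indexSet Ω z
    · rw [hG0 _ (fun h => Set.disjoint_left.mp hdisj h ⟨k, hkH, rfl⟩), mul_zero]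
    · have : F (k • z) = 0 := by
        by_cases h1 : k • z ∈ Ω
        -- `Ω` need not be symmetric: if only `-(k • z)` lies outside, Hermitian symmetry still
        -- kills `F (k • z)`.
        · have h2 : -(k • z) ∉ Ω := fun h => hkH ⟨hk, h1, h⟩
          have h3 := hF0 _ h2
          rwa [hFneg, map_eq_zero] at h3
        · exact hF0 _ h1
      rw [this, zero_mul]
  have hint : ∀ n : ℤ, 2 ≤ |n| → F (n • z) * G (n • z) = 0 := by
    intro n hn
    obtain ⟨k, rfl | rfl⟩ := n.eq_nat_or_neg
    · rw [natCast_zsmul]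
      exact hnat k (by simpa using hn)
    · rw [neg_smul, natCast_zsmul, hFneg, hGneg, ← map_mul, hnat k (by simpa using hn), map_zero]
  -- Schur product argument: expanding `G`, then `F`, as integrals against nonnegative densities
  -- leaves a pointwise squared modulus.
  have hpos : ∀ N : ℕ, 0 ≤ (∑ r ∈ range N ×ˢ range N, ((-1 : ℂ) ^ (r.1 + r.2)) *
      (F (((r.1 : ℤ) - (r.2 : ℤ)) • z) * G (((r.1 : ℤ) - (r.2 : ℤ)) • z))).re := by
    intro N
    have h1 := re_sum_integral_fourierChar_nonneg (range N ×ˢ range N)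
      (fun r => (-1 : ℂ) ^ (r.1 + r.2) * F (((r.1 : ℤ) - (r.2 : ℤ)) • z))
      (fun r => ((r.1 : ℤ) - (r.2 : ℤ)) • z) hq hq0 fun η => ?_
    · simpa only [mul_assoc] using h1
    · have h2 := re_sum_integral_fourierChar_nonneg (range N ×ˢ range N)
        (fun r => (-1 : ℂ) ^ (r.1 + r.2) * 𝐞 ⟪η, ((r.1 : ℤ) - (r.2 : ℤ)) • z⟫_ℝ)
        (fun r => ((r.1 : ℤ) - (r.2 : ℤ)) • z) hp hp0 fun ξ => ?_
      · simpa only [mul_assoc, mul_comm, mul_left_comm] using h2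
      · convert re_sum_sum_exp_nonneg N (2 * π * (⟪η, z⟫_ℝ + ⟪ξ, z⟫_ℝ)) using 2
        refine sum_congr rfl fun r _ => ?_
        rw [mul_assoc, ← Circle.coe_mul, ← AddChar.map_add_eq_mul, Real.fourierChar_apply]
        congr 2
        simp only [← Int.cast_smul_eq_zsmul ℝ, inner_smul_right]
        push_cast
        ring
  have hFz : F z = f z := hpf z (by simp)
  have hGz : G z = g z := hqg z (by simp)
  have hF00 : F 0 = 1 := (hpf 0 (by simp)).trans (by simp [hf0])
  have hG00 : G 0 = 1 := (hqg 0 (by simp)).trans (by simp [hg0])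
  have hineq : ∀ N : ℕ, 0 ≤ ((N : ℝ) + 1) - N * (2 * (f z * g z)) := by
    intro N
    have h1 := hpos (N + 1)
    have h2 := sum_sum_tridiagonal (fun n : ℤ => ((-1 : ℂˣ) ^ n : ℂˣ) * (F (n • z) * G (n • z)))
      (fun n hn => by simp only [hint n hn, mul_zero]) N
    have h3 : ∑ r ∈ range (N + 1) ×ˢ range (N + 1), ((-1 : ℂ) ^ (r.1 + r.2)) *
        (F (((r.1 : ℤ) - (r.2 : ℤ)) • z) * G (((r.1 : ℤ) - (r.2 : ℤ)) • z)) =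
        (((N + 1) - N * (2 * (f z * g z)) : ℝ) : ℂ) := by
      rw [sum_product]
      refine Eq.trans (sum_congr rfl fun j _ => sum_congr rfl fun l _ => ?_) (h2.trans ?_)
      · congr 1
        push_cast
        rw [zpow_sub₀ (by norm_num), pow_add, div_eq_mul_inv, zpow_natCast, zpow_natCast,
          ← inv_pow]
        norm_num
      · simp [hFneg, hGneg, hFz, hGz, hF00, hG00]
        ring
    rw [h3, Complex.ofReal_re] at h1
    exact h1
  by_contra! hlt
  obtain ⟨N, hN⟩ := exists_nat_gt (1 / (2 * (f z * g z) - 1))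
  rw [div_lt_iff₀ (by linarith)] at hN
  nlinarith [hineq N]

/-! ### Admissible functions built from nonnegative cosine polynomials. -/

section Kernel

variable {V : Type*} [NormedAddCommGroup V] [InnerProductSpace ℝ V] [MeasurableSpace V]
  [BorelSpace V] [FiniteDimensional ℝ V]

theorem fourier_comp_sub (φ : V → ℂ) (v ξ : V) :
    𝓕 (fun x => φ (x - v)) ξ = 𝐞 (-⟪v, ξ⟫_ℝ) • 𝓕 φ ξ := by
  have := congrFun (VectorFourier.fourierIntegral_comp_add_right 𝐞 volume (innerₗ V) φ (-v)) ξ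
  simpa [Function.comp_def, sub_eq_add_neg] using! this

theorem fourier_im_eq_zero_of_even {u : V → ℝ} (hu : ∀ x, u (-x) = u x) (ξ : V) :
    (𝓕 (fun x => (u x : ℂ)) ξ).im = 0 := by
  rw [← Complex.conj_eq_iff_im, Real.fourier_eq, ← integral_conj, ← integral_neg_eq_self]
  congr with x
  simp [Circle.smul_def, hu, AddChar.map_neg_eq_inv, ← Circle.coe_inv_eq_conj]

/-- There are smooth positive definite functions with arbitrarily small support. -/
theorem exists_posDef_kernel {r : ℝ} (hr : 0 < r) :
    ∃ φ : V → ℝ, ContDiff ℝ (⊤ : ℕ∞) φ ∧ HasCompactSupport φ ∧ (∀ x, r ≤ ‖x‖ → φ x = 0) ∧ φ 0 = 1 ∧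
      ∀ ξ, ∃ a : ℝ, 0 ≤ a ∧ 𝓕 (fun x => (φ x : ℂ)) ξ = a := by
  -- `u` lives in the ball of radius `r / 2`, so `u * u` lives in radius `r`. As `u` is even, its
  -- transform is real, and that of `u * u` is a real square.
  let u : ContDiffBump (0 : V) := ⟨r / 4, r / 2, by positivity, by linarith⟩
  let ψ : V → ℝ := convolution u u (ContinuousLinearMap.mul ℝ ℝ) volume
  have hsupp : ∀ x, r ≤ ‖x‖ → ψ x = 0 := by
    intro x hx
    by_contra hne
    obtain ⟨a, ha, b, hb, hab⟩ := support_convolution_subset (ContinuousLinearMap.mul ℝ ℝ)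
      (Function.mem_support.mpr hne)
    rw [u.support_eq, mem_ball_zero_iff] at ha hb
    have := norm_add_le a b
    change a + b = x at hab
    rw [hab] at this
    change ‖a‖ < r / 2 at ha
    change ‖b‖ < r / 2 at hb
    linarith
  have hψ0 : 0 < ψ 0 := by
    have e : ψ 0 = ∫ x, u x * u x := by
      change ∫ x, u x * u (0 - x) = _
      simp [u.neg]
    have hc : Continuous (fun x => u x * u x) := u.continuous.mul u.continuous
    rw [e]
    refine hc.integral_pos_of_hasCompactSupport_nonneg_nonzero u.hasCompactSupport.mul_right
      (fun x => mul_self_nonneg _) (x := 0) ?_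
    have h1 : u 0 = 1 := u.one_of_mem_closedBall (Metric.mem_closedBall_self u.rIn_pos.le)
    simp [h1]
  have hψF : ∀ ξ, ∃ a : ℝ, 0 ≤ a ∧ 𝓕 (fun x => (ψ x : ℂ)) ξ = a := by
    intro ξ
    have hu : Integrable (fun x => (u x : ℂ)) := u.integrable.ofReal
    have e : (fun x => (ψ x : ℂ)) = convolution (fun x => (u x : ℂ)) (fun x => (u x : ℂ))
        (ContinuousLinearMap.mul ℂ ℂ) volume := by
      ext x
      simp only [ψ, MeasureTheory.convolution, ContinuousLinearMap.mul_apply']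
      rw [← integral_complex_ofReal]
      simp
    refine ⟨(𝓕 (fun x => (u x : ℂ)) ξ).re ^ 2, sq_nonneg _, ?_⟩
    rw [e, Real.fourier_mul_convolution_eq hu hu]
    have him := fourier_im_eq_zero_of_even u.neg ξ
    apply Complex.ext <;> simp [him, sq]
  refine ⟨fun x => ψ x / ψ 0, ?_, ?_, fun x hx => by simp [hsupp x hx], div_self hψ0.ne', ?_⟩
  · exact (u.hasCompactSupport.contDiff_convolution_left _ u.contDiff
      u.continuous.locallyIntegrable).div_const _
  · refine HasCompactSupport.intro (isCompact_closedBall 0 r) fun x hx => ?_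
    rw [mem_closedBall_zero_iff, not_le] at hx
    simp [hsupp x hx.le]
  · intro ξ
    obtain ⟨a, ha, hae⟩ := hψF ξ
    refine ⟨a / ψ 0, by positivity, ?_⟩
    have : (fun x => ((ψ x / ψ 0 : ℝ) : ℂ)) = ((ψ 0 : ℂ)⁻¹) • (fun x => (ψ x : ℂ)) := by
      ext x; simp [div_eq_inv_mul]
    rw [this]
    have h := congrFun (VectorFourier.fourierIntegral_const_smul 𝐞 volume (innerₗ V)
      (fun x => (ψ x : ℂ)) ((ψ 0 : ℂ)⁻¹)) ξ
    refine h.trans ?_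
    rw [Pi.smul_apply]
    change (ψ 0 : ℂ)⁻¹ • 𝓕 (fun x => (ψ x : ℂ)) ξ = _
    rw [hae]
    simp [div_eq_inv_mul]

end Kernel

/-- A nonnegative cosine polynomial `1 + ∑ c k cos (k t)` with frequencies `k` such that `±kz ∈ Ω`
yields a smooth admissible function with value `c 1 / 2` at `z`. -/
theorem exists_admissible_of_cosine {z : EuclideanSpace ℝ (Fin d)} (hz : z ≠ 0)
    {Ω : Set (EuclideanSpace ℝ (Fin d))} (hΩ : IsOpen Ω) (c : ℕ →₀ ℝ)
    (hcΩ : ∀ k ∈ c.support, k • z ∈ Ω ∧ -(k • z) ∈ Ω) (hc0 : c 0 = 1)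
    (hc : ∀ t : ℝ, 0 ≤ c.sum fun k a => a * Real.cos (k * t)) :
    ∃ f ∈ admissible (smoothFunctions d) Ω, f z = c 1 / 2 := by
  let K : Set (EuclideanSpace ℝ (Fin d)) :=
    (fun k : ℕ => k • z) '' c.support ∪ (fun k : ℕ => -(k • z)) '' c.support
  have hK : IsCompact K :=
    ((c.support.finite_toSet.image _).union (c.support.finite_toSet.image _)).isCompact
  have hKΩ : K ⊆ Ω := by
    rintro _ (⟨k, hk, rfl⟩ | ⟨k, hk, rfl⟩)
    exacts [(hcΩ k hk).1, (hcΩ k hk).2]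
  obtain ⟨δ, hδ, hδΩ⟩ := hK.exists_cthickening_subset_open hΩ hKΩ
  have hzpos : 0 < ‖z‖ := norm_pos_iff.mpr hz
  -- Radius at most `δ` keeps the translates inside `Ω`; radius at most `‖z‖` makes `φ` vanish at
  -- all nonzero multiples of `z`.
  obtain ⟨φ, hφs, hφc, hφ0, hφ1, hφF⟩ := exists_posDef_kernel
    (V := EuclideanSpace ℝ (Fin d)) (lt_min hδ hzpos)
  have hφz : ∀ n : ℤ, n ≠ 0 → φ (n • z) = 0 := by
    intro n hn
    refine hφ0 _ ((min_le_right _ _).trans ?_)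
    rw [← Int.cast_smul_eq_zsmul ℝ, norm_smul]
    have : (1 : ℝ) ≤ ‖(n : ℝ)‖ := by
      rw [Real.norm_eq_abs, ← Int.cast_abs]
      exact_mod_cast Int.one_le_abs hn
    nlinarith
  -- The transform of `f` is that of `φ` times the cosine polynomial at `2π⟪z, ξ⟫`. The two
  -- translates coincide for `k = 0`, giving `f 0 = c 0`, but only one reaches `z` for `k = 1`,
  -- giving `c 1 / 2`.
  let f : EuclideanSpace ℝ (Fin d) → ℝ := fun x =>
    ∑ k ∈ c.support, c k / 2 * (φ (x - k • z) + φ (x - -(k • z)))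
  have hfsupp : tsupport f ⊆ Metric.cthickening δ K := by
    refine closure_minimal (fun x hx => ?_) Metric.isClosed_cthickening
    obtain ⟨k, hk, hne⟩ := exists_ne_zero_of_sum_ne_zero hx
    have h2 : φ (x - k • z) ≠ 0 ∨ φ (x - -(k • z)) ≠ 0 := by
      by_contra! h
      rw [h.1, h.2] at hne
      simp at hne
    have h3 : ∀ v, φ (x - v) ≠ 0 → v ∈ K → x ∈ Metric.cthickening δ K := by
      intro v hv hvK
      refine Metric.closedBall_subset_cthickening hvK δ ?_
      rw [mem_closedBall_iff_norm]
      by_contra! hlt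
      exact hv (hφ0 _ ((min_le_left _ _).trans hlt.le))
    rcases h2 with h2 | h2
    · exact h3 _ h2 (Or.inl ⟨k, hk, rfl⟩)
    · exact h3 _ h2 (Or.inr ⟨k, hk, rfl⟩)
  refine ⟨f, ⟨⟨?_, ?_⟩, hfsupp.trans hδΩ, ?_, ?_⟩, ?_⟩
  · exact ContDiff.sum fun k _ => contDiff_const.mul
      ((hφs.comp (contDiff_id.sub contDiff_const)).add (hφs.comp (contDiff_id.sub contDiff_const)))
  · exact hK.cthickening.of_isClosed_subset (isClosed_tsupport f) hfsupp
  · have : ∀ k ∈ c.support, c k / 2 * (φ (0 - k • z) + φ (0 - -(k • z))) =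
        if k = 0 then 1 else 0 := by
      intro k _
      rcases eq_or_ne k 0 with rfl | hk
      · norm_num [hφ1, hc0]
      · have h1 := hφz (-k) (by simpa using hk)
        have h2 := hφz k (by simpa using hk)
        rw [neg_smul, natCast_zsmul] at h1
        rw [natCast_zsmul] at h2
        simp [h1, h2, hk]
    simp only [f]
    rw [sum_congr rfl this, sum_ite_eq', if_pos (by simp [hc0])]
  · intro ξ
    obtain ⟨a, ha, hae⟩ := hφF ξ
    have hint : Integrable (fun x => (φ x : ℂ)) :=
      (hφs.continuous.integrable_of_hasCompactSupport hφc).ofReal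
    have key : 𝓕 (fun x => (f x : ℂ)) ξ =
        (((c.sum fun k a => a * Real.cos (k * (2 * π * ⟪z, ξ⟫_ℝ))) * a : ℝ) : ℂ) := by
      have hi : ∀ v, Integrable (fun x => 𝐞 (-⟪x, ξ⟫_ℝ) • (φ (x - v) : ℂ)) := fun v =>
        (Real.fourierIntegral_convergent_iff ξ).2 (hint.comp_sub_right v)
      have hs : ∀ v, ∫ x, 𝐞 (-⟪x, ξ⟫_ℝ) • (φ (x - v) : ℂ) = 𝐞 (-⟪v, ξ⟫_ℝ) • (a : ℂ) := by
        intro v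
        rw [← hae, ← fourier_comp_sub, Real.fourier_eq]
      have hfe : ∀ x, 𝐞 (-⟪x, ξ⟫_ℝ) • (f x : ℂ) = ∑ k ∈ c.support, ((c k / 2 : ℝ) : ℂ) *
          (𝐞 (-⟪x, ξ⟫_ℝ) • (φ (x - k • z) : ℂ) + 𝐞 (-⟪x, ξ⟫_ℝ) • (φ (x - -(k • z)) : ℂ)) := by
        intro x
        simp only [f, Complex.ofReal_sum, smul_sum, Circle.smul_def, smul_eq_mul]
        refine sum_congr rfl fun k _ => ?_
        push_cast
        ring
      rw [Real.fourier_eq]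
      simp_rw [hfe]
      have hadd : ∀ k : ℕ, Integrable fun x => ((c k / 2 : ℝ) : ℂ) *
          (𝐞 (-⟪x, ξ⟫_ℝ) • (φ (x - k • z) : ℂ) + 𝐞 (-⟪x, ξ⟫_ℝ) • (φ (x - -(k • z)) : ℂ)) :=
        fun k => ((hi (k • z)).add (hi (-(k • z)))).const_mul _
      rw [integral_finsetSum c.support fun k _ => hadd k]
      simp_rw [integral_const_mul]
      rw [Finsupp.sum, sum_mul, Complex.ofReal_sum]
      refine sum_congr rfl fun k _ => ?_
      rw [integral_add (hi _) (hi _), hs, hs, Circle.smul_def, Circle.smul_def,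
        Real.fourierChar_apply, Real.fourierChar_apply]
      simp only [← Nat.cast_smul_eq_nsmul ℝ, inner_neg_left, inner_smul_left]
      push_cast
      rw [Complex.cos]
      simp only [smul_eq_mul, neg_neg, mul_neg, neg_mul]
      simp only [conj_trivial, Complex.ofReal_natCast]
      ring_nf
    rw [key]
    exact ⟨Complex.ofReal_im _, mul_nonneg (hc _) ha⟩
  · have : ∀ k ∈ c.support, c k / 2 * (φ (z - k • z) + φ (z - -(k • z))) =
        if k = 1 then c 1 / 2 else 0 := by
      intro k _
      have h2 := hφz (1 + k) (by omega)
      rw [add_smul, one_smul, natCast_zsmul] at h2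
      rcases eq_or_ne k 1 with rfl | hk
      · rw [one_smul] at h2
        simp [hφ1, h2]
      · have h1 := hφz (1 - k) (by omega)
        rw [sub_smul, one_smul, natCast_zsmul] at h1
        simp [h1, h2, hk]
    simp only [f]
    rw [sum_congr rfl this, sum_ite_eq']
    split_ifs with h
    · rfl
    · simp [Finsupp.notMem_support_iff.mp h]

/-! ### Duality for nonnegative cosine polynomials. -/

/-- The value at `t` of the cosine polynomial with coefficients `c`. -/
noncomputable def cosEval (t : ℝ) : (ℕ →₀ ℝ) →ₗ[ℝ] ℝ :=
  Finsupp.linearCombination ℝ fun k : ℕ => Real.cos (k * t)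

theorem cosEval_apply (t : ℝ) (c : ℕ →₀ ℝ) :
    cosEval t c = c.sum fun k a => a * Real.cos (k * t) := rfl

theorem cosEval_single (t : ℝ) (k : ℕ) (a : ℝ) :
    cosEval t (Finsupp.single k a) = a * Real.cos (k * t) := by
  simp [cosEval]

/-- The cone of coefficient sequences of nonnegative cosine polynomials. -/
noncomputable def cosCone : PointedCone ℝ (ℕ →₀ ℝ) where
  carrier := {c | ∀ t, 0 ≤ cosEval t c}
  add_mem' ha hb t := by rw [map_add]; exact add_nonneg (ha t) (hb t)
  zero_mem' t := by rw [map_zero]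
  smul_mem' r c hc t := by
    have : cosEval t (r • c) = (r : ℝ) * cosEval t c := (cosEval t).map_smul (r : ℝ) c
    rw [this]
    exact mul_nonneg r.2 (hc t)

theorem smul_mem_cosCone {c : ℕ →₀ ℝ} (hc : c ∈ cosCone) {r : ℝ} (hr : 0 ≤ r) :
    r • c ∈ cosCone :=
  Submodule.smul_mem cosCone (⟨r, hr⟩ : NNReal) hc

/-- The constant coefficient is the mean over a period. -/
theorem apply_zero_nonneg_of_mem_cosCone {c : ℕ →₀ ℝ} (hc : c ∈ cosCone) : 0 ≤ c 0 := by
  have hk : ∀ k : ℕ, ∫ t in (0 : ℝ)..(2 * π), c k * Real.cos (k * t) =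
      if k = 0 then 2 * π * c 0 else 0 := by
    intro k
    rcases eq_or_ne k 0 with rfl | hk
    · simp
    · have hk' : (k : ℝ) ≠ 0 := Nat.cast_ne_zero.mpr hk
      rw [intervalIntegral.integral_const_mul,
        intervalIntegral.integral_comp_mul_left (fun x => Real.cos x) hk', integral_cos]
      have : Real.sin (k * (2 * π)) = 0 := by
        rw [← Real.sin_nat_mul_pi (2 * k)]; push_cast; ring_nf
      simp [this, hk]
  have h1 : ∫ t in (0 : ℝ)..(2 * π), cosEval t c = 2 * π * c 0 := by
    simp only [cosEval_apply, Finsupp.sum]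
    rw [intervalIntegral.integral_finsetSum fun k _ =>
      (by fun_prop : Continuous fun t : ℝ => c k * Real.cos (k * t)).intervalIntegrable _ _]
    simp_rw [hk]
    rw [sum_ite_eq']
    split_ifs with h
    · rfl
    · simp [Finsupp.notMem_support_iff.mp h]
  have h2 : 0 ≤ ∫ t in (0 : ℝ)..(2 * π), cosEval t c :=
    intervalIntegral.integral_nonneg (by positivity) fun t _ => hc t
  rw [h1] at h2
  exact nonneg_of_mul_nonneg_right h2 (by positivity)

/-- Homogeneous form of the extremal bound. Since `c 0` may vanish, a small positive constant is
added before normalizing. -/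
theorem apply_one_le_mul_of_mem_cosCone {S : Set ℕ} (h0 : 0 ∈ S) {m : ℝ}
    (hm : ∀ c ∈ cosCone, c ∈ Finsupp.supported ℝ ℝ S → c 0 = 1 → c 1 ≤ m)
    {c : ℕ →₀ ℝ} (hc : c ∈ cosCone) (hcS : c ∈ Finsupp.supported ℝ ℝ S) : c 1 ≤ m * c 0 := by
  have hc0 := apply_zero_nonneg_of_mem_cosCone hc
  have hsS : Finsupp.single 0 (1 : ℝ) ∈ Finsupp.supported ℝ ℝ S :=
    Finsupp.single_mem_supported ℝ _ h0
  have hs : Finsupp.single 0 (1 : ℝ) ∈ cosCone := fun t => by simp [cosEval_single]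
  have hm0 : 0 ≤ m := by simpa using hm _ hs hsS (by simp)
  refine le_of_forall_pos_le_add fun ε hε => ?_
  have hη : 0 < ε / (m + 1) := by positivity
  have hpos : 0 < c 0 + ε / (m + 1) := by positivity
  have := hm ((c 0 + ε / (m + 1))⁻¹ • (c + (ε / (m + 1)) • Finsupp.single 0 1))
    (smul_mem_cosCone (add_mem hc (smul_mem_cosCone hs hη.le)) (by positivity))
    (Submodule.smul_mem _ _ (add_mem hcS (Submodule.smul_mem _ _ hsS)))
    (by simpa [← mul_add] using inv_mul_cancel₀ hpos.ne')
  simp at this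
  rw [inv_mul_le_iff₀ hpos] at this
  have h2 : m * (ε / (m + 1)) ≤ ε := by
    rw [mul_div_assoc', div_le_iff₀ (by positivity)]
    nlinarith
  linarith

/-- Duality for the extremal problem `sup c 1` among nonnegative cosine polynomials with `c 0 = 1`
and frequencies in `S`. -/
theorem exists_dual_functional {S : Set ℕ} (h0 : 0 ∈ S) (h1 : 1 ∈ S) {m : ℝ}
    (hm : ∀ c ∈ cosCone, c ∈ Finsupp.supported ℝ ℝ S → c 0 = 1 → c 1 ≤ m) :
    ∃ g : (ℕ →₀ ℝ) →ₗ[ℝ] ℝ, g (Finsupp.single 0 1) = m ∧ g (Finsupp.single 1 1) = -1 ∧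
      (∀ k ∈ S, 2 ≤ k → g (Finsupp.single k 1) = 0) ∧ ∀ c ∈ cosCone, 0 ≤ g c := by
  let L : (ℕ →₀ ℝ) →ₗ[ℝ] ℝ := m • Finsupp.lapply 0 - Finsupp.lapply 1
  obtain ⟨g, hg, hpos⟩ := riesz_extension cosCone
    ⟨Finsupp.supported ℝ ℝ S, L.comp (Finsupp.supported ℝ ℝ S).subtype⟩
    (fun x hx => by
      have := apply_one_le_mul_of_mem_cosCone h0 hm hx x.2
      change 0 ≤ m * (x : ℕ →₀ ℝ) 0 - (x : ℕ →₀ ℝ) 1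
      linarith)
    -- Cofinality for Riesz extension: the constant `∑ |y k|` dominates the cosine polynomial of
    -- `y`.
    (fun y => by
      refine ⟨⟨Finsupp.single 0 (∑ k ∈ y.support, |y k|), Finsupp.single_mem_supported ℝ _ h0⟩,
        fun t => ?_⟩
      change 0 ≤ cosEval t (Finsupp.single 0 (∑ k ∈ y.support, |y k|) + y)
      rw [map_add, cosEval_single, cosEval_apply, Finsupp.sum]
      simp only [Nat.cast_zero, zero_mul, Real.cos_zero, mul_one]
      rw [← sum_add_distrib]
      refine sum_nonneg fun k _ => ?_
      have : |y k * Real.cos (k * t)| ≤ |y k| := by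
        rw [abs_mul]
        exact mul_le_of_le_one_right (abs_nonneg _) (Real.abs_cos_le_one _)
      linarith [neg_abs_le (y k * Real.cos (k * t))])
  have hgS : ∀ k ∈ S, g (Finsupp.single k 1) = L (Finsupp.single k 1) := fun k hk =>
    hg ⟨Finsupp.single k 1, Finsupp.single_mem_supported ℝ _ hk⟩
  refine ⟨g, ?_, ?_, fun k hk hk2 => ?_, hpos⟩
  · rw [hgS 0 h0]; simp [L]
  · rw [hgS 1 h1]; simp [L]
  · rw [hgS k hk]
    simp [L, show k ≠ 0 by omega, show k ≠ 1 by omega]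

/-! ### Fejér sums, turning a dual functional back into cosine polynomials. -/

theorem sum_sum_cos_nonneg (N : ℕ) (θ : ℝ) :
    0 ≤ ∑ j ∈ range N, ∑ l ∈ range N, Real.cos ((((j : ℤ) - l : ℤ) : ℝ) * θ) := by
  have : ∑ j ∈ range N, ∑ l ∈ range N, Real.cos ((((j : ℤ) - l : ℤ) : ℝ) * θ) =
      (∑ j ∈ range N, Real.cos (j * θ)) ^ 2 + (∑ j ∈ range N, Real.sin (j * θ)) ^ 2 := by
    rw [sq, sq, sum_mul_sum, sum_mul_sum, ← sum_add_distrib]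
    refine sum_congr rfl fun j _ => ?_
    rw [← sum_add_distrib]
    refine sum_congr rfl fun l _ => ?_
    rw [← Real.cos_sub]
    push_cast
    ring_nf
  rw [this]
  positivity

theorem cos_natAbs_mul (n : ℤ) (θ : ℝ) : Real.cos ((n.natAbs : ℝ) * θ) = Real.cos (n * θ) := by
  obtain h | h := Int.natAbs_eq n
  · conv_rhs => rw [h]
    simp
  · conv_rhs => rw [h]
    simp

/-- Fejér-type sums of cosine polynomials are nonnegative. -/
theorem sum_sum_single_cos_mem_cosCone (N : ℕ) (τ : ℝ) :
    ∑ j ∈ range N, ∑ l ∈ range N, Finsupp.single ((j : ℤ) - l).natAbs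
      (Real.cos ((((j : ℤ) - l : ℤ) : ℝ) * τ)) ∈ cosCone := by
  intro s
  simp only [map_sum, cosEval_single, cos_natAbs_mul]
  -- Product-to-sum reduces the claim to Fejér sums at `τ + s` and `τ - s`.
  have : ∑ j ∈ range N, ∑ l ∈ range N, Real.cos ((((j : ℤ) - l : ℤ) : ℝ) * τ) *
      Real.cos ((((j : ℤ) - l : ℤ) : ℝ) * s) =
      (∑ j ∈ range N, ∑ l ∈ range N, Real.cos ((((j : ℤ) - l : ℤ) : ℝ) * (τ + s)) +
        ∑ j ∈ range N, ∑ l ∈ range N, Real.cos ((((j : ℤ) - l : ℤ) : ℝ) * (τ - s))) / 2 := by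
    rw [← sum_add_distrib, sum_div]
    refine sum_congr rfl fun j _ => ?_
    rw [← sum_add_distrib, sum_div]
    refine sum_congr rfl fun l _ => ?_
    rw [mul_add, mul_sub, Real.cos_add, Real.cos_sub]
    ring
  rw [this]
  linarith [sum_sum_cos_nonneg N (τ + s), sum_sum_cos_nonneg N (τ - s)]

/-- A functional nonnegative on `cosCone` produces nonnegative cosine polynomials. -/
theorem exists_cosCone_of_functional {g : (ℕ →₀ ℝ) →ₗ[ℝ] ℝ} (hg : ∀ c ∈ cosCone, 0 ≤ g c)
    (N : ℕ) : ∃ c ∈ cosCone, c 0 = (N + 1) * g (Finsupp.single 0 1) ∧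
      c 1 = -(2 * N * g (Finsupp.single 1 1)) ∧
      ∀ k, g (Finsupp.single k 1) = 0 → c k = 0 := by
  let v : ℤ → ℕ →₀ ℝ := fun n =>
    Finsupp.single n.natAbs ((-1 : ℝ) ^ n * g (Finsupp.single n.natAbs 1))
  have hgs : ∀ k a, g (Finsupp.single k a) = a * g (Finsupp.single k 1) := fun k a => by
    rw [← smul_eq_mul, ← map_smul, Finsupp.smul_single, smul_eq_mul, mul_one]
  refine ⟨∑ j ∈ range (N + 1), ∑ l ∈ range (N + 1), v ((j : ℤ) - l), fun t => ?_, ?_, ?_,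
    fun k hk => ?_⟩
  -- The value at `t` is `g` of a Fejér element of the cone; the shift by `π` produces the signs
  -- `(-1)^n`.
  · have h := hg _ (sum_sum_single_cos_mem_cosCone (N + 1) (t + π))
    refine h.trans_eq ?_
    simp only [map_sum, v, cosEval_single, cos_natAbs_mul]
    refine sum_congr rfl fun j _ => sum_congr rfl fun l _ => ?_
    rw [hgs, mul_add, Real.cos_add_int_mul_pi]
    ring
  · simp only [Finsupp.finsetSum_apply]
    rw [sum_sum_tridiagonal (fun n => v n 0) (fun n hn => ?_) N]
    · simp [v]
    · simp only [v]
      rw [Finsupp.single_eq_of_ne]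
      intro h
      have : n = 0 := by omega
      simp [this] at hn
  · simp only [Finsupp.finsetSum_apply]
    rw [sum_sum_tridiagonal (fun n => v n 1) (fun n hn => ?_) N]
    · simp [v]
      ring
    · simp only [v]
      rw [Finsupp.single_eq_of_ne]
      intro h
      rw [Int.abs_eq_natAbs, ← h] at hn
      norm_num at hn
  · simp only [Finsupp.finsetSum_apply]
    refine sum_eq_zero fun j _ => sum_eq_zero fun l _ => ?_
    simp only [v]
    rw [Finsupp.single_apply]
    split_ifs with h
    · rw [h, hk, mul_zero]
    · rfl

end BoasKac

/-! ### The duality identity. -/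

open BoasKac

theorem mainTheorem12 {d : ℕ} (z : EuclideanSpace ℝ (Fin d))
    (C : Set (EuclideanSpace ℝ (Fin d) → ℝ))
    (hC_smooth : BoasKac.smoothFunctions d ⊆ C)
    (hC_integrable : C ⊆ BoasKac.integrableFunctions z)
    (Ω Ωs : Set (EuclideanSpace ℝ (Fin d)))
    (hΩ : IsOpen Ω) (h0 : 0 ∈ Ω) (hz : z ∈ Ω) (hnz : -z ∈ Ω)
    (hΩs : IsOpen Ωs) (hΩs_symm : ∀ x ∈ Ωs, -x ∈ Ωs) (hs0 : 0 ∈ Ωs) (hsz : z ∈ Ωs)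
    (hs_contains :
      (fun k : ℕ => k • z) '' (Set.Ici 2 \ BoasKac.indexSet Ω z) ⊆ Ωs)
    (hs_disjoint :
      Disjoint Ωs ((fun k : ℕ => k • z) '' BoasKac.indexSet Ω z)) :
    BoasKac.extremal C Ω z * BoasKac.extremal C Ωs z = 1 / 2 := by
  have hz0 : z ≠ 0 := by
    rintro rfl
    -- If `z = 0`, then `2 ∈ H` and `2 • z = 0` would lie in both disjoint sets.
    exact Set.disjoint_left.mp hs_disjoint hs0 ⟨2, ⟨le_rfl, by simpa, by simpa⟩, by simp⟩
  have hmul : ∀ f ∈ admissible C Ω, ∀ g ∈ admissible C Ωs, f z * g z ≤ 1 / 2 :=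
    fun f hf g hg => mul_apply_le_half hC_integrable hs_disjoint hf hg
  have hexists : ∀ {U : Set (EuclideanSpace ℝ (Fin d))}, IsOpen U → ∀ c ∈ cosCone, c 0 = 1 →
      (∀ k, c k ≠ 0 → k • z ∈ U ∧ -(k • z) ∈ U) → ∃ f ∈ admissible C U, f z = c 1 / 2 := by
    intro U hU c hc hc0 hcU
    obtain ⟨f, ⟨hfs, hf⟩, hfz⟩ := exists_admissible_of_cosine hz0 hU c
      (fun k hk => hcU k (Finsupp.mem_support_iff.mp hk)) hc0 hc
    exact ⟨f, ⟨hC_smooth hfs, hf⟩, hfz⟩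
  have hhalf : ∀ {U : Set (EuclideanSpace ℝ (Fin d))}, IsOpen U → 0 ∈ U → z ∈ U → -z ∈ U →
      ∃ f ∈ admissible C U, f z = 1 / 2 := by
    intro U hU hU0 hUz hUnz
    -- The polynomial `1 + cos t` gives value `1/2`. Such a function on one side bounds the values
    -- on the other by `1`, so both suprema are finite, and they are positive.
    obtain ⟨f, hf, hfz⟩ := hexists hU (Finsupp.single 0 1 + Finsupp.single 1 1)
      (fun t => by
        rw [map_add, cosEval_single, cosEval_single]
        simp only [Nat.cast_zero, zero_mul, Real.cos_zero, Nat.cast_one, one_mul]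
        linarith [Real.neg_one_le_cos t]) (by simp) (fun k hk => by
        rcases eq_or_ne k 0 with rfl | h0
        · simpa using hU0
        rcases eq_or_ne k 1 with rfl | h1
        · simpa using ⟨hUz, hUnz⟩
        · simp [h0, h1] at hk)
    exact ⟨f, hf, by simpa using hfz⟩
  obtain ⟨f₀, hf₀, hf₀z⟩ := hhalf hΩ h0 hz hnz
  obtain ⟨g₀, hg₀, hg₀z⟩ := hhalf hΩs hs0 hsz (hΩs_symm z hsz)
  have hbdd : BddAbove ((fun f => f z) '' admissible C Ω) := by
    refine ⟨1, ?_⟩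
    rintro _ ⟨f, hf, rfl⟩
    have := hmul f hf g₀ hg₀
    rw [hg₀z] at this
    dsimp only
    linarith
  have hbdds : BddAbove ((fun f => f z) '' admissible C Ωs) := by
    refine ⟨1, ?_⟩
    rintro _ ⟨g, hg, rfl⟩
    have := hmul f₀ hf₀ g hg
    rw [hf₀z] at this
    dsimp only
    linarith
  have hle : ∀ f ∈ admissible C Ω, f z ≤ extremal C Ω z := fun f hf => le_csSup hbdd ⟨f, hf, rfl⟩
  have hles : ∀ g ∈ admissible C Ωs, g z ≤ extremal C Ωs z :=
    fun g hg => le_csSup hbdds ⟨g, hg, rfl⟩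
  have hpos : 0 < extremal C Ω z := by linarith [hle f₀ hf₀]
  refine le_antisymm ?_ ?_
  · rw [mul_comm, ← le_div_iff₀ hpos]
    refine csSup_le ⟨_, g₀, hg₀, rfl⟩ ?_
    rintro _ ⟨g, hg, rfl⟩
    dsimp only
    rw [le_div_iff₀ hpos]
    rcases le_or_gt (g z) 0 with hneg | hgpos
    · nlinarith
    · rw [mul_comm, ← le_div_iff₀ hgpos]
      refine csSup_le ⟨_, f₀, hf₀, rfl⟩ ?_
      rintro _ ⟨f, hf, rfl⟩
      exact (le_div_iff₀ hgpos).mpr (hmul f hf g hg)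
  · have hS : ∀ c ∈ cosCone, c ∈ Finsupp.supported ℝ ℝ ({0, 1} ∪ indexSet Ω z) → c 0 = 1 →
        c 1 ≤ 2 * extremal C Ω z := by
      intro c hc hcS hc0
      obtain ⟨f, hf, hfz⟩ := hexists hΩ c hc hc0 (fun k hk => by
        rcases hcS (Finsupp.mem_support_iff.mpr hk) with (rfl | rfl) | hkH
        · simpa using h0
        · simpa using ⟨hz, hnz⟩
        · exact hkH.2)
      linarith [hle f hf]
    obtain ⟨g, hg0, hg1, hgH, hgpos⟩ :=
      exists_dual_functional (Or.inl (by simp)) (Or.inl (by simp)) hS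
    -- The dual functional gives `c 0 = (N + 1) · 2 𝓜(Ω, z)` and `c 1 = 2N`; the normalized
    -- polynomial is then a competitor for `Ωs`.
    have hN : ∀ N : ℕ, (N : ℝ) ≤ (N + 1) * (2 * (extremal C Ω z * extremal C Ωs z)) := by
      intro N
      obtain ⟨c, hc, hc0, hc1, hck⟩ := exists_cosCone_of_functional hgpos N
      rw [hg0] at hc0
      rw [hg1] at hc1
      have hc0pos : 0 < c 0 := by rw [hc0]; positivity
      obtain ⟨f, hf, hfz⟩ := hexists hΩs ((c 0)⁻¹ • c)
        (smul_mem_cosCone hc (inv_nonneg.mpr hc0pos.le))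
        (by simpa using inv_mul_cancel₀ hc0pos.ne') (fun k hk => by
          have hkΩ : k • z ∈ Ωs := by
            rcases eq_or_ne k 0 with rfl | hk0
            · simpa using hs0
            rcases eq_or_ne k 1 with rfl | hk1
            · simpa using hsz
            have hk2 : 2 ≤ k := by omega
            refine hs_contains ⟨k, ⟨hk2, fun hkH => hk ?_⟩, rfl⟩
            simp [hck k (hgH k (Or.inr hkH) hk2)]
          exact ⟨hkΩ, hΩs_symm _ hkΩ⟩)
      have h := hles f hf
      rw [hfz, Finsupp.smul_apply, smul_eq_mul, hc1, mul_div_assoc, inv_mul_le_iff₀ hc0pos,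
        hc0] at h
      linarith
    by_contra! hlt
    obtain ⟨N, hN'⟩ := exists_nat_gt
      (1 / (1 - 2 * (extremal C Ω z * extremal C Ωs z)))
    rw [div_lt_iff₀ (by linarith)] at hN'
    nlinarith [hN N]
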